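/- All rings are commutative with unit. An element $b$ of a ring $R$ is integral over an ideal $I$ of $R$ if $b^n+u_1b^{n-1}+\cdots+u_n=0$ for some $n\ge 1$ and some $u_l\in I^l$ ($1\le l\le n$). The ring $R$ (not necessarily a domain) is called normal if, for all $a,b\in R$, whenever $b$ is integral over the principal ideal $\langle a\rangle$ we have $b\in\langle a\rangle$. Theorem. Let $R$ be a normal ring and let $f\in R[X]$ be a monic polynomial. Let $S=R[X]/\langle f\rangle$, let $x\in S$ be the image of $X$, and let $f'$ be the formal derivative of $f$. Then the localization $R_{\{f\}}=S[1/f'(x)]$ is a normal ring. -/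

import Mathlib

open Polynomial

/-- An element `b` of a commutative ring is integral over an ideal `I` if it satisfies a relation
`b ^ n + u₁ * b ^ (n - 1) + ⋯ + uₙ = 0` with `n ≥ 1` and `uₗ ∈ I ^ l` for `1 ≤ l ≤ n`. -/
def IsIntegralOverIdeal {R : Type*} [CommRing R] (I : Ideal R) (b : R) : Prop :=
  ∃ (n : ℕ) (u : ℕ → R), 1 ≤ n ∧ (∀ l ∈ Finset.Icc 1 n, u l ∈ I ^ l) ∧
    b ^ n + ∑ l ∈ Finset.Icc 1 n, u l * b ^ (n - l) = 0

/-- A commutative ring is normal if every element that is integral over a principal ideal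
belongs to that ideal. -/
def IsNormalRing (R : Type*) [CommRing R] : Prop :=
  ∀ a b : R, IsIntegralOverIdeal (Ideal.span {a}) b → b ∈ Ideal.span {a}

/-- The localization `S[1/f'(x)]`, where `S = R[X]/⟨f⟩` and `x` is the image of `X` in `S`. -/
abbrev DerivLocalization {R : Type*} [CommRing R] (f : R[X]) : Type _ :=
  Localization.Away (aeval (AdjoinRoot.root f) (derivative f) : AdjoinRoot f)

open scoped TensorProduct

/-! Inverting `f'` makes the algebra standard étale over `R`, so it suffices that étale algebras
preserve normality. Membership in a principal ideal can be tested at the maximal ideals of `R`, and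
there a normal ring localizes to an integrally closed domain `A` with fraction field `K`. For `S`
étale over `A`, the ring `S ⊗ K` contains `S` and is étale over a field, hence von Neumann regular,
so `b` can be divided by `a` there. The quotient is integral over `S`; as integral closure commutes
with smooth base change, it lies in `S`. -/

/-- Integrality over a principal ideal, expressed by a monic polynomial with scaled roots. -/
theorem isIntegralOverIdeal_span_singleton_iff {R : Type*} [CommRing R] [Nontrivial R] {a b : R} :
    IsIntegralOverIdeal (Ideal.span {a}) b ↔
      ∃ p : R[X], p.Monic ∧ p.natDegree ≠ 0 ∧ (p.scaleRoots a).eval b = 0 := by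
  have key (n : ℕ) (v : ℕ → R) : ∑ l ∈ Finset.Icc 1 n, v l * a ^ l * b ^ (n - l) =
      ∑ i ∈ Finset.range n, v (n - i) * a ^ (n - i) * b ^ i := by
    refine Finset.sum_nbij' (n - ·) (n - ·) ?_ ?_ ?_ ?_ ?_
    · intro l hl; simp only [Finset.mem_Icc, Finset.mem_range] at *; omega
    · intro l hl; simp only [Finset.mem_Icc, Finset.mem_range] at *; omega
    · intro l hl; simp only [Finset.mem_Icc] at *; omega
    · intro l hl; simp only [Finset.mem_range] at *; omega
    · intro l hl
      simp only [Finset.mem_Icc] at hl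
      rw [Nat.sub_sub_self hl.2]
  constructor
  · rintro ⟨n, u, hn, hu, h⟩
    have hu' (l : ℕ) : ∃ c, l ∈ Finset.Icc 1 n → u l = c * a ^ l := by
      by_cases hl : l ∈ Finset.Icc 1 n
      · have := hu l hl
        rw [Ideal.span_singleton_pow, Ideal.mem_span_singleton'] at this
        obtain ⟨c, hc⟩ := this
        exact ⟨c, fun _ ↦ hc.symm⟩
      · exact ⟨0, fun h ↦ absurd h hl⟩
    choose c hc using hu'
    set q : R[X] := ∑ i ∈ Finset.range n, C (c (n - i)) * X ^ i with hq
    have hqd : q.degree < n := by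
      refine (degree_sum_le _ _).trans_lt ((Finset.sup_lt_iff (WithBot.bot_lt_coe n)).mpr ?_)
      intro i hi
      exact (degree_C_mul_X_pow_le _ _).trans_lt (Nat.cast_lt.mpr (Finset.mem_range.mp hi))
    have hd : (X ^ n + q).natDegree = n := by
      rw [natDegree_add_eq_left_of_degree_lt (by simpa using hqd), natDegree_X_pow]
    refine ⟨X ^ n + q, monic_X_pow_add hqd, by omega, ?_⟩
    rw [eval_eq_sum_range, natDegree_scaleRoots, hd, Finset.sum_range_succ, add_comm, ← h]
    have hc0 : q.coeff n = 0 := coeff_eq_zero_of_degree_lt hqd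
    congr 1
    · simp [coeff_scaleRoots, hd, hc0]
    · rw [Finset.sum_congr (s₁ := Finset.Icc 1 n) rfl (fun l hl ↦ by rw [hc l hl]), key n c]
      refine Finset.sum_congr rfl fun i hi ↦ ?_
      have hi' := Finset.mem_range.mp hi
      have : q.coeff i = c (n - i) := by
        simp [hq, coeff_X_pow, hi']
      rw [coeff_scaleRoots, hd, coeff_add, coeff_X_pow, if_neg hi'.ne, zero_add, this]
  · rintro ⟨p, hp, hp0, h⟩
    refine ⟨p.natDegree, fun l ↦ p.coeff (p.natDegree - l) * a ^ l, Nat.pos_of_ne_zero hp0, ?_, ?_⟩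
    · intro l _
      rw [Ideal.span_singleton_pow]
      exact Ideal.mul_mem_left _ _ (Ideal.mem_span_singleton_self _)
    · rw [← h, key _ (fun l ↦ p.coeff (p.natDegree - l)), eval_eq_sum_range, natDegree_scaleRoots,
        Finset.sum_range_succ, add_comm]
      congr 1
      · refine Finset.sum_congr rfl fun i hi ↦ ?_
        rw [coeff_scaleRoots, Nat.sub_sub_self (Finset.mem_range.mp hi).le]
      · simp [hp.leadingCoeff]

theorem IsIntegralOverIdeal.map_span_singleton {R S : Type*} [CommRing R] [CommRing S]
    (φ : R →+* S) {a b : R} (h : IsIntegralOverIdeal (Ideal.span {a}) b) :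
    IsIntegralOverIdeal (Ideal.span {φ a}) (φ b) := by
  obtain ⟨n, u, hn, hu, h⟩ := h
  refine ⟨n, fun l ↦ φ (u l), hn, fun l hl ↦ ?_, ?_⟩
  · have := Ideal.mem_map_of_mem φ (hu l hl)
    rwa [Ideal.map_pow, Ideal.map_span, Set.image_singleton] at this
  · simpa using congr(φ $h)

theorem IsNormalRing.of_ringEquiv {R S : Type*} [CommRing R] [CommRing S] (hR : IsNormalRing R)
    (e : R ≃+* S) : IsNormalRing S := by
  intro a b h
  have := hR _ _ (h.map_span_singleton e.symm.toRingHom)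
  rw [Ideal.mem_span_singleton] at this ⊢
  simpa using map_dvd e this

/-- In a normal ring a zero product splits along a comaximal pair of elements. -/
theorem IsNormalRing.exists_mul_eq_zero {R : Type*} [CommRing R] (hR : IsNormalRing R) {a b : R}
    (hab : a * b = 0) : ∃ s, (1 - s) * a = 0 ∧ s * b = 0 := by
  have hred : ∀ x : R, x ^ 2 = 0 → x = 0 := by
    intro x hx
    have := hR 0 x ⟨2, fun _ ↦ 0, by norm_num, by simp, by simpa using hx⟩
    simpa using this
  -- The relation is `a² - (a + b)a = -ab = 0`.
  have hint : IsIntegralOverIdeal (Ideal.span {a + b}) a := by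
    refine ⟨2, fun l ↦ if l = 1 then -(a + b) else 0, by norm_num, fun l _ ↦ ?_, ?_⟩
    · dsimp only
      split_ifs with hl
      · rw [hl, pow_one]
        exact neg_mem (Ideal.mem_span_singleton_self _)
      · exact zero_mem _
    · simp
      linear_combination -hab
  obtain ⟨s, hs⟩ := Ideal.mem_span_singleton'.mp (hR _ _ hint)
  have h1 : (1 - s) * a = 0 := by
    -- From `s(a + b) = a` follows `(1 - s)a = sb`, so the square is a multiple of `ab`.
    refine hred _ ?_
    linear_combination (1 - s) * s * hab - (1 - s) * a * hs
  exact ⟨s, h1, by linear_combination hs + h1⟩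

theorem IsNormalRing.isDomain_localization {R : Type*} [CommRing R] (hR : IsNormalRing R)
    (m : Ideal R) [m.IsPrime] : IsDomain (Localization.AtPrime m) := by
  have : NoZeroDivisors (Localization.AtPrime m) := by
    refine ⟨fun {x y} hxy ↦ ?_⟩
    obtain ⟨a, s, rfl⟩ := IsLocalization.exists_mk'_eq m.primeCompl x
    obtain ⟨b, t, rfl⟩ := IsLocalization.exists_mk'_eq m.primeCompl y
    rw [← IsLocalization.mk'_mul, IsLocalization.mk'_eq_zero_iff] at hxy
    obtain ⟨u, hu⟩ := hxy
    obtain ⟨r, hr1, hr2⟩ := hR.exists_mul_eq_zero (a := u * a) (b := b) (by rw [mul_assoc, hu])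
    -- One of `r`, `1 - r` lies outside `m`, so it becomes a unit and kills a factor.
    by_cases hr : r ∈ m
    · left
      have : 1 - r ∉ m := fun h ↦
        ‹m.IsPrime›.ne_top (m.eq_top_iff_one.mpr (by simpa using m.add_mem h hr))
      refine (IsLocalization.mk'_eq_zero_iff _ _).mpr ⟨⟨1 - r, this⟩ * u, ?_⟩
      simpa [mul_assoc] using hr1
    · right
      exact (IsLocalization.mk'_eq_zero_iff _ _).mpr ⟨⟨r, hr⟩, hr2⟩
  exact NoZeroDivisors.to_isDomain _

theorem IsNormalRing.isIntegrallyClosed_localization {R : Type*} [CommRing R]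
    (hR : IsNormalRing R) (m : Ideal R) [m.IsPrime] :
    IsIntegrallyClosed (Localization.AtPrime m) := by
  have := hR.isDomain_localization m
  let A := Localization.AtPrime m
  let K := FractionRing A
  refine (isIntegrallyClosed_iff K).mpr fun {z} hz ↦ ?_
  -- Clearing denominators gives an equation over `R` itself, where normality applies.
  obtain ⟨s, hs⟩ := hz.exists_multiple_integral_of_isLocalization m.primeCompl z
  obtain ⟨α, β, hβ, hαβ⟩ := IsFractionRing.div_surjective (A := A) (s • z)
  obtain ⟨⟨a, t⟩, ha⟩ := IsLocalization.surj m.primeCompl α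
  obtain ⟨⟨b, t'⟩, hb⟩ := IsLocalization.surj m.primeCompl β
  have hunit (x : m.primeCompl) : algebraMap R K x ≠ 0 := by
    rw [IsScalarTower.algebraMap_apply R A K]
    exact ((IsLocalization.map_units A x).map (algebraMap A K)).ne_zero
  have hβ' : algebraMap A K β ≠ 0 := by simpa using nonZeroDivisors.ne_zero hβ
  have ha' : algebraMap A K α * algebraMap R K t = algebraMap R K a := by
    simpa [← IsScalarTower.algebraMap_apply] using congr(algebraMap A K $ha)
  have hb' : algebraMap A K β * algebraMap R K t' = algebraMap R K b := by
    simpa [← IsScalarTower.algebraMap_apply] using congr(algebraMap A K $hb)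
  have hden : algebraMap R K (b * t) ≠ 0 := by
    rw [map_mul, ← hb']
    exact mul_ne_zero (mul_ne_zero hβ' (hunit t')) (hunit t)
  have hfrac : algebraMap R K (b * t) * (s • z) = algebraMap R K (a * t') := by
    rw [← hαβ, map_mul, map_mul, ← ha', ← hb']
    have := div_mul_cancel₀ (algebraMap A K α) hβ'
    linear_combination (algebraMap R K t * algebraMap R K t') * this
  have hRnt : Nontrivial R := (algebraMap R K).domain_nontrivial
  obtain ⟨p, hp, hps⟩ := hs
  have hp0 : p.natDegree ≠ 0 := by
    intro h0
    rw [hp.natDegree_eq_zero.mp h0] at hps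
    simp at hps
  have hK : algebraMap R K ((p.scaleRoots (b * t)).eval (a * t')) = 0 := by
    rw [← eval₂_at_apply, ← hfrac, scaleRoots_eval₂_mul, hps, mul_zero]
  rw [IsScalarTower.algebraMap_apply R A K, FaithfulSMul.algebraMap_eq_zero_iff,
    IsLocalization.map_eq_zero_iff m.primeCompl] at hK
  obtain ⟨u, hu⟩ := hK
  -- The equation holds in `R` only after multiplication by `u`; scaling both elements by `u`
  -- multiplies it by a positive power of `u`.
  have hint : IsIntegralOverIdeal (Ideal.span {b * t * u}) (u * (a * t')) := by
    refine isIntegralOverIdeal_span_singleton_iff.mpr ⟨p, hp, hp0, ?_⟩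
    rw [scaleRoots_mul, scaleRoots_eval_mul, natDegree_scaleRoots,
      ← Nat.sub_add_cancel (Nat.pos_of_ne_zero hp0), pow_add, pow_one, mul_assoc, hu, mul_zero]
  obtain ⟨c, hc⟩ := Ideal.mem_span_singleton'.mp (hR _ _ hint)
  have hsz : s • z = algebraMap R K c := by
    refine mul_left_cancel₀ (mul_ne_zero (hunit u) hden) ?_
    rw [mul_assoc, hfrac, ← map_mul, ← hc]
    simp only [map_mul]
    ring
  refine ⟨IsLocalization.mk' A c s, mul_left_cancel₀ (hunit s) ?_⟩
  rw [IsScalarTower.algebraMap_apply R A K, ← map_mul, IsLocalization.mk'_spec',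
    ← IsScalarTower.algebraMap_apply, ← hsz, Submonoid.smul_def, Algebra.smul_def,
    ← IsScalarTower.algebraMap_apply]

/-- The algebra is Artinian and reduced: the powers of `a` stabilize up to a factor `y`, which makes
`a(ay - 1)` nilpotent, hence zero. -/
theorem exists_eq_sq_mul_of_etale {K T : Type*} [Field K] [CommRing T] [Algebra K T]
    [Algebra.Etale K T] (a : T) : ∃ a', a ^ 2 * a' = a := by
  have := Algebra.FormallyUnramified.finite_of_free K T
  have : IsArtinianRing T := .of_finite K T
  have := Algebra.FormallyUnramified.isReduced_of_field K T
  obtain ⟨n, y, hy⟩ := IsArtinian.exists_pow_succ_smul_dvd a (1 : T)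
  simp only [smul_eq_mul, mul_one, Nat.succ_eq_add_one] at hy
  refine ⟨y, sub_eq_zero.mp (pow_eq_zero_iff (n := n + 1) (by simp) |>.mp ?_)⟩
  have : a ^ 2 * y - a = a * (a * y - 1) := by ring
  rw [this, mul_pow]
  linear_combination a * (a * y - 1) ^ n * hy

/-- An étale algebra over an integrally closed domain is normal. -/
theorem IsNormalRing.of_etale_of_isIntegrallyClosed {A S : Type*} [CommRing A] [IsDomain A]
    [IsIntegrallyClosed A] [CommRing S] [Algebra A S] [Algebra.Etale A S] : IsNormalRing S := by
  intro a b hab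
  nontriviality S
  obtain ⟨p, hp, hp0, h⟩ := isIntegralOverIdeal_span_singleton_iff.mp hab
  let K := FractionRing A
  let e : K ⊗[A] S ≃ₐ[A] S ⊗[A] K := Algebra.TensorProduct.comm A K S
  have hred : IsReduced (S ⊗[A] K) := by
    have := Algebra.FormallyUnramified.isReduced_of_field K (K ⊗[A] S)
    exact isReduced_of_injective e.symm e.symm.injective
  let φ := algebraMap S (S ⊗[A] K)
  have hφ : Function.Injective φ :=
    Algebra.TensorProduct.includeLeft_injective (S := A) (IsFractionRing.injective A K)
  obtain ⟨a', ha'⟩ : ∃ a', φ a ^ 2 * a' = φ a := by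
    obtain ⟨y, hy⟩ := exists_eq_sq_mul_of_etale (K := K) (e.symm (φ a))
    exact ⟨e y, by simpa using congr(e $hy)⟩
  have : Nontrivial (S ⊗[A] K) := hφ.nontrivial
  have hT : ((p.map φ).scaleRoots (φ a)).eval (φ b) = 0 := by
    rw [← map_scaleRoots _ _ _ (by simp [hp.leadingCoeff]), eval_map_apply, h, map_zero]
  have hT' (u : S ⊗[A] K) : ((p.map φ).scaleRoots (φ a * u)).eval (u * φ b) = 0 := by
    rw [scaleRoots_mul, scaleRoots_eval_mul, hT, mul_zero]
  -- Scaling the equation by `1 - aa'`, which kills `a`, leaves only its leading term.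
  have hb : (1 - φ a * a') * φ b = 0 := by
    have := hT' (1 - φ a * a')
    rw [show φ a * (1 - φ a * a') = 0 by linear_combination -ha', scaleRoots_zero] at this
    simp only [eval_pow, eval_X, (hp.map φ).leadingCoeff, one_smul] at this
    exact eq_zero_of_pow_eq_zero this
  have he : IsIntegral S (φ a * a') := by
    refine ⟨X ^ 2 - X, by monicity!, ?_⟩
    simp
    linear_combination a' * ha'
  -- Scaled by `a'`, the equation has coefficients in `S[aa']`, integral over `S` because `aa'` is
  -- idempotent.
  have hc : IsIntegral S (a' * φ b) := by
    refine .of_aeval_monic_of_isIntegral_coeff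
      ((monic_scaleRoots_iff (φ a * a')).mpr (hp.map φ)) ?_ ?_ ?_
    · rwa [natDegree_scaleRoots, hp.natDegree_map]
    · rw [hT']
      exact isIntegral_zero
    · intro i
      rw [coeff_scaleRoots, coeff_map]
      exact isIntegral_algebraMap.mul (he.pow _)
  obtain ⟨w, hw⟩ := (TensorProduct.toIntegralClosure_bijective_of_smooth
    (R := A) (S := S) (B := K)).surjective ⟨_, hc⟩
  obtain ⟨s, hs⟩ : ∃ s, φ s = a' * φ b := by
    rw [← show _ = a' * φ b from congr_arg Subtype.val hw]
    clear hw
    induction w with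
    | zero => exact ⟨0, by simp⟩
    | add x y hx hy =>
      obtain ⟨s, hs⟩ := hx
      obtain ⟨t, ht⟩ := hy
      exact ⟨s + t, by simp [hs, ht]⟩
    | tmul x y =>
      obtain ⟨r, hr⟩ := IsIntegrallyClosed.isIntegral_iff.mp y.2
      refine ⟨r • x, ?_⟩
      change (r • x) ⊗ₜ[A] (1 : K) = x ⊗ₜ[A] y.1
      rw [← hr, Algebra.algebraMap_eq_smul_one, TensorProduct.smul_tmul]
  refine Ideal.mem_span_singleton'.mpr ⟨s, hφ ?_⟩
  rw [map_mul, hs]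
  linear_combination -hb

/-- Étale algebras over normal rings are normal. -/
theorem IsNormalRing.of_etale {R S : Type*} [CommRing R] [CommRing S] [Algebra R S]
    [Algebra.Etale R S] (hR : IsNormalRing R) : IsNormalRing S := by
  intro a b hab
  -- The conductor of all `r` with `r • b ∈ ⟨a⟩`; the localization at `m` yields an element of it
  -- outside `m`.
  let J : Ideal R :=
    (Submodule.restrictScalars R (Ideal.span {a})).comap (LinearMap.toSpanSingleton R S b)
  suffices J = ⊤ by
    have : (1 : R) ∈ J := this ▸ Submodule.mem_top
    simpa [J] using this
  by_contra hJ
  obtain ⟨m, hm, hJm⟩ := Ideal.exists_le_maximal J hJ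
  let A := Localization.AtPrime m
  have := hR.isDomain_localization m
  have := hR.isIntegrallyClosed_localization m
  let _ : Algebra S (A ⊗[R] S) := Algebra.TensorProduct.rightAlgebra
  have : IsLocalization (Algebra.algebraMapSubmonoid S m.primeCompl) (A ⊗[R] S) := inferInstance
  have hT : IsNormalRing (A ⊗[R] S) := .of_etale_of_isIntegrallyClosed (A := A)
  obtain ⟨z, hz⟩ := Ideal.mem_span_singleton'.mp
    (hT _ _ (hab.map_span_singleton (algebraMap S (A ⊗[R] S))))
  obtain ⟨s, ⟨_, r, hr, rfl⟩, rfl⟩ :=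
    IsLocalization.exists_mk'_eq (Algebra.algebraMapSubmonoid S m.primeCompl) z
  have hz' : algebraMap S (A ⊗[R] S) (s * a) = algebraMap S (A ⊗[R] S) (algebraMap R S r * b) := by
    rw [map_mul, map_mul, ← hz, ← mul_assoc]
    congr 1
    exact (IsLocalization.mk'_spec' (A ⊗[R] S) s
      ⟨algebraMap R S r, Algebra.mem_algebraMapSubmonoid_of_mem ⟨r, hr⟩⟩).symm
  obtain ⟨⟨v, hv⟩, h⟩ :=
    (IsLocalization.eq_iff_exists (Algebra.algebraMapSubmonoid S m.primeCompl) _).mp hz'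
  obtain ⟨u, hu, rfl⟩ := hv
  refine m.primeCompl.mul_mem hu hr (hJm ?_)
  change (u * r) • b ∈ Ideal.span {a}
  refine Ideal.mem_span_singleton'.mpr ⟨algebraMap R S u * s, ?_⟩
  rw [Algebra.smul_def, map_mul, mul_assoc, mul_assoc]
  exact h

theorem etale_derivLocalization {R : Type*} [CommRing R] (f : R[X]) (hf : f.Monic) :
    Algebra.Etale R (DerivLocalization f) := by
  -- The witnesses `1, 0, 1` encode `f' * 1 + f * 0 = f' ^ 1`.
  let P : StandardEtalePair R := ⟨f, hf, derivative f, 1, 0, 1, by simp⟩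
  have := Algebra.Etale.of_equiv P.equivAwayAdjoinRoot
  unfold DerivLocalization
  rw [AdjoinRoot.aeval_eq]
  exact this

theorem mainTheorem3 {R : Type*} [CommRing R] (hR : IsNormalRing R) (f : R[X]) (hf : f.Monic) :
    IsNormalRing (DerivLocalization f) := by
  have := etale_derivLocalization f hf
  exact hR.of_etale
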